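/- Let $n\ge 1$ be an integer and $q>1$ a real number. On $\ell^2(\mathbb Z_{\ge 0})$, with orthonormal basis $(e_j)_{j\ge0}$, let $\gamma e_j=q^{-(j+1)}e_j$ and $\alpha e_j=\sqrt{1-q^{-2(j+1)}}\,e_{j+1}$; let $t$ be the bilateral shift $e_s\mapsto e_{s+1}$ on $\ell^2(\mathbb Z)$. The algebra $C(\mathbb S_q^{2n+1})$ of the quantum sphere is the C*-algebra of operators on $\ell^2(\mathbb Z)\otimes\ell^2(\mathbb Z_{\ge0})^{\otimes n}$ generated by $$u_{n+1,m}=t\otimes\gamma^{\otimes(n+1-m)}\otimes\alpha^*\otimes 1^{\otimes(m-2)}\quad(2\le m\le n+1),\qquad u_{n+1,1}=t\otimes\gamma^{\otimes n}.$$ The group $U(1)$ acts on it by *-automorphisms $\tau_z$, $z\in U(1)$, with $\tau_z(u_{n+1,m})=z\,u_{n+1,m}$ for all $m$. Let $C(\mathbb CP_q^n)$ be the fixed-point algebra of $\tau$ and, for $k\in\mathbb Z$, let the quantum line bundle of degree $k$ be the spectral subspace $$L_k=\{a\in C(\mathbb S_q^{2n+1}) : \tau_z(a)=z^k a \text{ for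 all } z\in U(1)\},$$ a left module over $C(\mathbb CP_q^n)$ by multiplication. For $m\ge 0$ let $P_m$ be the projection of $\ell^2(\mathbb Z_{\ge0})$ onto $\mathrm{span}(e_0,\dots,e_{m-1})$, $I$ the identity, and $P_{-m}=I-P_m$ (with $P_{-0}:=I$). An operator $T$ on $\ell^2(\mathbb Z_{\ge0})^{\otimes n}$ is identified with $1\otimes T$ on $\ell^2(\mathbb Z)\otimes\ell^2(\mathbb Z_{\ge0})^{\otimes n}$. The left module determined by a projection $P\in M_N(A)$ over a C*-algebra $A$ is $A^N P$ (row vectors), and $\boxplus$ denotes the diagonal sum of matrices. Theorem. All the elementary tensor products below lie in $C(\mathbb CP_q^n)$, and the left $C(\mathbb CP_q^n)$-module $L_k$ is isomorphic to the finitely generated projective left module over $C(\mathbb CP_q^n)$ determined by - the projection $P_{-|k|}\otimes\left(\otimes^{n-1}I\right)$, if $k\le 0$; - the projection $\displaystyle\boxplus_{j=0}^{n}\Bigl(\boxplus^{\binom{k+j-1}{j}}\bigl((\otimes^{j}P_1)\otimes(\otimes^{n-j}I)\bigr)\Bigr)$, if $k>0$. -/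

import Mathlib

open scoped ENNReal

noncomputable section

namespace QSphere

/-- The operator `f ↦ (i ↦ c i * f (φ i))` on `ℓ²(ι)`, for an injective map `φ` and weights `c` of
modulus at most one. On the standard orthonormal basis it sends `e_(φ i)` to `c i • e_i` and kills
every basis vector outside the range of `φ`. -/
def weightedComp {ι : Type*} (c : ι → ℂ) (φ : ι → ι) (hφ : Function.Injective φ)
    (hc : ∀ i, ‖c i‖ ≤ 1) :
    lp (fun _ : ι => ℂ) 2 →L[ℂ] lp (fun _ : ι => ℂ) 2 :=
  have h2 : (0 : ℝ) < (2 : ℝ≥0∞).toReal := by norm_num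
  have hs : ∀ f : lp (fun _ : ι => ℂ) 2,
      Summable fun i => ‖f (φ i)‖ ^ (2 : ℝ≥0∞).toReal := fun f =>
    ((lp.memℓp f).summable h2).comp_injective hφ
  have hb : ∀ (f : lp (fun _ : ι => ℂ) 2) (i : ι),
      ‖c i * f (φ i)‖ ^ (2 : ℝ≥0∞).toReal ≤ ‖f (φ i)‖ ^ (2 : ℝ≥0∞).toReal := fun f i =>
    Real.rpow_le_rpow (norm_nonneg _)
      (by rw [norm_mul]; exact mul_le_of_le_one_left (norm_nonneg _) (hc i)) h2.le
  have hm : ∀ f : lp (fun _ : ι => ℂ) 2, Memℓp (fun i => c i * f (φ i)) 2 := fun f =>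
    memℓp_gen (Summable.of_nonneg_of_le
      (fun _ => Real.rpow_nonneg (norm_nonneg _) _) (hb f) (hs f))
  LinearMap.mkContinuous
    { toFun := fun f => ⟨fun i => c i * f (φ i), hm f⟩
      map_add' := fun f g => by
        ext i
        exact mul_add (c i) (f (φ i)) (g (φ i))
      map_smul' := fun a f => by
        ext i
        exact mul_left_comm (c i) a (f (φ i)) }
    1 (fun f => by
      rw [one_mul]
      refine lp.norm_le_of_tsum_le h2 (norm_nonneg _) ?_
      rw [lp.norm_rpow_eq_tsum h2 f]
      refine (Summable.tsum_le_tsum (hb f) (Summable.of_nonneg_of_le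
        (fun _ => Real.rpow_nonneg (norm_nonneg _) _) (hb f) (hs f)) (hs f)).trans ?_
      exact tsum_comp_le_tsum_of_inj ((lp.memℓp f).summable h2)
        (fun _ => Real.rpow_nonneg (norm_nonneg _) _) hφ)

theorem weightedComp_apply {ι : Type*} (c : ι → ℂ) (φ : ι → ι) (hφ : Function.Injective φ)
    (hc : ∀ i, ‖c i‖ ≤ 1) (f : lp (fun _ : ι => ℂ) 2) (i : ι) :
    weightedComp c φ hφ hc f i = c i * f (φ i) := rfl

/-- The Hilbert space `ℓ²(ℤ × ℕⁿ) = ℓ²(ℤ) ⊗ ℓ²(ℕ) ⊗ ⋯ ⊗ ℓ²(ℕ)`. -/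
abbrev H (n : ℕ) : Type := lp (fun _ : ℤ × (Fin n → ℕ) => ℂ) 2

/-- The algebra of bounded operators on `ℓ²(ℤ × ℕⁿ)`. -/
abbrev B (n : ℕ) : Type := H n →L[ℂ] H n

/-- Eigenvalues of the operator `γ` on `ℓ²(ℕ)`: `γ e_j = q^{-(j+1)} e_j`. -/
def gammaWt (q : ℝ) (j : ℕ) : ℝ := (q ^ (j + 1))⁻¹

/-- Weights of the operator `α` on `ℓ²(ℕ)`: `α e_j = (1 - q^{-2(j+1)})^{1/2} e_{j+1}`, so that
`α* e_{j+1} = (1 - q^{-2(j+1)})^{1/2} e_j` and `α* e_0 = 0`. For `q > 1` the operators `α` and `γ`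
satisfy `α*α + γ*γ = 1`, `αα* + q²γγ* = 1`, `αγ = qγα`, `γ*γ = γγ*`, `αγ* = qγ*α`, that is, they
form the irreducible representation of the generators of `C(SU_q(2))`. -/
def alphaWt (q : ℝ) (j : ℕ) : ℝ := √(1 - (q ^ (j + 1))⁻¹ ^ 2)

theorem gammaWt_nonneg {q : ℝ} (hq : 1 < q) (j : ℕ) : 0 ≤ gammaWt q j := by
  unfold gammaWt; positivity

theorem gammaWt_le_one {q : ℝ} (hq : 1 < q) (j : ℕ) : gammaWt q j ≤ 1 :=
  inv_le_one_of_one_le₀ (one_le_pow₀ hq.le)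

theorem alphaWt_le_one (q : ℝ) (j : ℕ) : alphaWt q j ≤ 1 := by
  unfold alphaWt
  refine Real.sqrt_le_one.mpr ?_
  linarith [sq_nonneg (q ^ (j + 1))⁻¹]

/-- The weight of `γ ⊗ ⋯ ⊗ γ ⊗ α* ⊗ 1 ⊗ ⋯ ⊗ 1` with `l < n` factors `γ`, respectively of
`γ ⊗ ⋯ ⊗ γ` for `l = n`, in front of the basis vector `e_w` of `ℓ²(ℕⁿ)`. -/
def genWt (n : ℕ) (q : ℝ) (l : Fin (n + 1)) (w : Fin n → ℕ) : ℝ :=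
  ∏ i : Fin n,
    if i.val < l.val then gammaWt q (w i) else if i.val = l.val then alphaWt q (w i) else 1

/-- The basis vector which `S ⊗ 1 ⊗ ⋯ ⊗ S* ⊗ ⋯ ⊗ 1` (bilateral shift on `ℓ²(ℤ)`, backward
shift on leg `l` of `ℓ²(ℕ)^{⊗n}` if `l < n`) sends to `e_{(s,w)}`. -/
def genSrc (n : ℕ) (l : Fin (n + 1)) (p : ℤ × (Fin n → ℕ)) : ℤ × (Fin n → ℕ) :=
  (p.1 - 1, fun i => if i.val = l.val then p.2 i + 1 else p.2 i)

theorem genSrc_injective (n : ℕ) (l : Fin (n + 1)) : Function.Injective (genSrc n l) := by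
  rintro ⟨s, w⟩ ⟨s', w'⟩ h
  simp only [genSrc, Prod.mk.injEq, sub_left_inj] at h
  refine Prod.ext h.1 (funext fun i => ?_)
  have := congrFun h.2 i
  by_cases hi : i.val = l.val <;> simpa [hi] using this

theorem norm_genWt_le_one (n : ℕ) {q : ℝ} (hq : 1 < q) (l : Fin (n + 1)) (w : Fin n → ℕ) :
    ‖((genWt n q l w : ℝ) : ℂ)‖ ≤ 1 := by
  rw [Complex.norm_real, genWt, Real.norm_of_nonneg]
  · refine Finset.prod_le_one (fun i _ => ?_) (fun i _ => ?_) <;> split_ifs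
    exacts [gammaWt_nonneg hq _, Real.sqrt_nonneg _, zero_le_one, gammaWt_le_one hq _,
      alphaWt_le_one q _, le_rfl]
  · refine Finset.prod_nonneg fun i _ => ?_
    split_ifs
    exacts [gammaWt_nonneg hq _, Real.sqrt_nonneg _, zero_le_one]

/-- The standard generators of the quantum sphere of dimension `2n+1`, as operators on
`ℓ²(ℤ) ⊗ ℓ²(ℕ)^{⊗n}`: with `t` the bilateral shift `e_s ↦ e_{s+1}` on `ℓ²(ℤ)`,
`gen l = t ⊗ γ^{⊗l} ⊗ α* ⊗ 1^{⊗(n-1-l)}` for `l < n` and `gen n = t ⊗ γ^{⊗n}`.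
With `l = n + 1 - m` this is the entry `u_{n+1,m}` of the fundamental matrix of `SU_q(n+1)`. -/
def gen (n : ℕ) (q : ℝ) (hq : 1 < q) (l : Fin (n + 1)) : B n :=
  weightedComp (fun p => ((genWt n q l p.2 : ℝ) : ℂ)) (genSrc n l) (genSrc_injective n l)
    (fun p => norm_genWt_le_one n hq l p.2)

/-- `C(S_q^{2n+1})`: the C*-algebra generated by the standard generators. -/
def sphere (n : ℕ) (q : ℝ) (hq : 1 < q) : StarSubalgebra ℂ (B n) :=
  (StarAlgebra.adjoin ℂ (Set.range (gen n q hq))).topologicalClosure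

theorem gen_mem (n : ℕ) (q : ℝ) (hq : 1 < q) (l : Fin (n + 1)) : gen n q hq l ∈ sphere n q hq :=
  StarSubalgebra.le_topologicalClosure _ (StarAlgebra.subset_adjoin ℂ _ ⟨l, rfl⟩)

/-! ### The `U(1)`-action -/

/-- The diagonal operator `e_{(s,w)} ↦ t^s e_{(s,w)}`. -/
def gaugeOp (n : ℕ) (t : Circle) : B n :=
  weightedComp (fun p => ((t ^ p.1 : Circle) : ℂ)) id Function.injective_id
    (fun _ => (Circle.norm_coe _).le)

theorem gaugeOp_apply (n : ℕ) (t : Circle) (f : H n) (p : ℤ × (Fin n → ℕ)) :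
    gaugeOp n t f p = ((t ^ p.1 : Circle) : ℂ) * f p := rfl

theorem gaugeOp_mul (n : ℕ) (s t : Circle) : gaugeOp n s * gaugeOp n t = gaugeOp n (s * t) := by
  ext f p
  simp [gaugeOp_apply, mul_zpow, mul_assoc]

theorem gaugeOp_one (n : ℕ) : gaugeOp n 1 = 1 := by
  ext f p
  simp [gaugeOp_apply]

theorem star_gaugeOp (n : ℕ) (t : Circle) : star (gaugeOp n t) = gaugeOp n t⁻¹ := by
  rw [ContinuousLinearMap.star_eq_adjoint, eq_comm, ContinuousLinearMap.eq_adjoint_iff]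
  intro f g
  rw [lp.inner_eq_tsum, lp.inner_eq_tsum]
  refine tsum_congr fun p => ?_
  rw [gaugeOp_apply, gaugeOp_apply, inv_zpow, Circle.coe_inv_eq_conj]
  simp only [RCLike.inner_apply, map_mul, Complex.conj_conj]
  ring

/-- The unitary `e_{(s,w)} ↦ t^s e_{(s,w)}`. -/
def gaugeUnitary (n : ℕ) (t : Circle) : unitary (B n) :=
  ⟨gaugeOp n t, by
    rw [Unitary.mem_iff, star_gaugeOp, gaugeOp_mul, gaugeOp_mul]
    simp [gaugeOp_one]⟩

/-- Conjugation by the unitary `e_{(s,w)} ↦ t^s e_{(s,w)}`. -/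
def gauge (n : ℕ) (t : Circle) : B n ≃⋆ₐ[ℂ] B n :=
  Unitary.conjStarAlgAut ℂ (B n) (gaugeUnitary n t)

theorem gauge_apply (n : ℕ) (t : Circle) (a : B n) :
    gauge n t a = gaugeOp n t * a * gaugeOp n t⁻¹ := by
  rw [← star_gaugeOp]; rfl

theorem gauge_gen (n : ℕ) (q : ℝ) (hq : 1 < q) (t : Circle) (l : Fin (n + 1)) :
    gauge n t (gen n q hq l) = (t : ℂ) • gen n q hq l := by
  rw [gauge_apply]
  ext f p
  have ht : (t : ℂ) ≠ 0 := Circle.coe_ne_zero t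
  simp only [mul_apply_eq_comp, gaugeOp_apply, gen, weightedComp_apply,
    smul_apply, lp.coeFn_smul, Pi.smul_apply, smul_eq_mul, genSrc,
    Circle.coe_zpow, inv_zpow', neg_sub, zpow_sub₀ ht, zpow_one]
  field_simp

theorem continuous_gauge (n : ℕ) (t : Circle) : Continuous (gauge n t) := by
  have : (gauge n t : B n → B n) = fun a => gaugeOp n t * a * gaugeOp n t⁻¹ :=
    funext (gauge_apply n t)
  rw [this]
  fun_prop

theorem gauge_mem (n : ℕ) (q : ℝ) (hq : 1 < q) (t : Circle) {a : B n} (ha : a ∈ sphere n q hq) :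
    gauge n t a ∈ sphere n q hq := by
  let g : B n →⋆ₐ[ℂ] B n := (gauge n t : B n →⋆ₐ[ℂ] B n)
  have hle : sphere n q hq ≤ (sphere n q hq).comap g := by
    refine StarSubalgebra.topologicalClosure_minimal (StarAlgebra.adjoin_le ?_) ?_
    · rintro _ ⟨l, rfl⟩
      change gauge n t (gen n q hq l) ∈ sphere n q hq
      rw [gauge_gen]
      exact SMulMemClass.smul_mem _ (gen_mem n q hq l)
    · exact (StarSubalgebra.isClosed_topologicalClosure _).preimage (continuous_gauge n t)
  exact hle ha

/-- The `U(1)`-action on `C(S_q^{2n+1})`. -/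
def action (n : ℕ) (q : ℝ) (hq : 1 < q) (t : Circle) : sphere n q hq →⋆ₐ[ℂ] sphere n q hq :=
  StarAlgHom.codRestrict ((gauge n t : B n →⋆ₐ[ℂ] B n).comp (sphere n q hq).subtype)
    (sphere n q hq) (fun a => gauge_mem n q hq t a.2)

/-- The action multiplies every standard generator by `t`, which determines it. -/
theorem action_gen (n : ℕ) (q : ℝ) (hq : 1 < q) (t : Circle) (l : Fin (n + 1)) :
    action n q hq t ⟨gen n q hq l, gen_mem n q hq l⟩ =
      (t : ℂ) • (⟨gen n q hq l, gen_mem n q hq l⟩ : sphere n q hq) :=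
  Subtype.ext (gauge_gen n q hq t l)

/-! ### The quantum projective space and its line bundles -/

/-- `C(ℂP_q^n)`: the fixed-point algebra of the `U(1)`-action on `C(S_q^{2n+1})`. -/
def projSpace (n : ℕ) (q : ℝ) (hq : 1 < q) : StarSubalgebra ℂ (sphere n q hq) where
  carrier := {a | ∀ t : Circle, action n q hq t a = a}
  mul_mem' := fun ha hb t => by rw [map_mul, ha t, hb t]
  add_mem' := fun ha hb t => by rw [map_add, ha t, hb t]
  algebraMap_mem' := fun z t => AlgHomClass.commutes (action n q hq t) z
  star_mem' := fun ha t => by rw [map_star, ha t]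

/-- `L_k`: the degree-`k` spectral subspace of `C(S_q^{2n+1})`, as a left module over
`C(ℂP_q^n)`. -/
def lineBundle (n : ℕ) (q : ℝ) (hq : 1 < q) (k : ℤ) :
    Submodule (projSpace n q hq) (sphere n q hq) where
  carrier := {a | ∀ t : Circle, action n q hq t a = ((t : ℂ) ^ k) • a}
  add_mem' := fun ha hb t => by rw [map_add, ha t, hb t, smul_add]
  zero_mem' := fun t => by rw [map_zero, smul_zero]
  smul_mem' := fun c a ha t => by
    change action n q hq t ((c : sphere n q hq) * a) = _ • ((c : sphere n q hq) * a)
    rw [map_mul, c.2 t, ha t, mul_smul_comm]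

/-! ### Elementary projections and the modules they determine -/

open Classical in
/-- For subsets `E 0, …, E (n-1)` of `ℕ`, the operator `1 ⊗ E_0 ⊗ ⋯ ⊗ E_{n-1}` on
`ℓ²(ℤ) ⊗ ℓ²(ℕ)^{⊗n}`, where `E_i` also denotes the projection of `ℓ²(ℕ)` onto the closed span of
the `e_j` with `j ∈ E_i`. -/
def tensorProj (n : ℕ) (E : Fin n → Set ℕ) : B n :=
  weightedComp (fun p => if ∀ i, p.2 i ∈ E i then 1 else 0) id Function.injective_id
    (fun p => by split_ifs <;> simp)

/-- `P_{-m} ⊗ I ⊗ ⋯ ⊗ I`, where `P_{-m} = I - P_m` projects onto the span of the `e_j`,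
`j ≥ m`. -/
def negProj (n m : ℕ) : B n :=
  tensorProj n (fun i => if i.val = 0 then {j | m ≤ j} else Set.univ)

/-- `P_1 ⊗ ⋯ ⊗ P_1 ⊗ I ⊗ ⋯ ⊗ I` with `j` factors `P_1`, where `P_1` projects onto the span of
`e_0`. -/
def stdProj (n j : ℕ) : B n :=
  tensorProj n (fun i => if i.val < j then {0} else Set.univ)

/-- The left module `A^N P` of a square matrix `P` over a ring `A`. -/
def matrixModule {A ι : Type*} [Ring A] [Fintype ι] (P : Matrix ι ι A) : Submodule A (ι → A) :=
  LinearMap.range (Matrix.vecMulLinear P)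

/-- The diagonal sum `⊞_{j=0}^{n} ⊞^{c j} p_j` of elements of `A`, a square matrix over `A`. -/
def boxSum {A : Type*} [Ring A] (n : ℕ) (c : ℕ → ℕ) (p : Fin (n + 1) → A) :
    Matrix (Σ j : Fin (n + 1), Fin (c j)) (Σ j : Fin (n + 1), Fin (c j)) A :=
  Matrix.diagonal (fun x => p x.1)

end QSphere

end

noncomputable section

namespace QSphere

/-! ### Weighted composition operators -/

/-! A finite family `b` in `L_k` with `b x * star (b y) = δ_{xy} p x` and `∑ star (b x) * b x = 1`
acts as an orthogonal frame: `a ↦ (a * star (b x))_x` identifies `L_k` with the module of the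
diagonal matrix of the `p x` (`nonempty_equiv_matrixModule_diagonal`). The task is to find such
frames inside the sphere algebra.

On the corner where the first `l` legs are in state `e_0`, the weights of `gen l` are bounded below.
Hence functional calculus extracts its phase `v_l = t ⊗ P_1^{⊗l} ⊗ S* ⊗ 1`, with `S*` the backward
shift (`v_n = t ⊗ P_1^{⊗n}`). Since `P_1^{⊗l} ⊗ 1 - v_l* v_l = P_1^{⊗(l+1)} ⊗ 1`, corners and phases
are obtained alternately (`shiftOp_single_mem`, `stdProj_mem`).

For `k ≤ 0` the frame is the single isometry `(v_0^{|k|})*`. For `k > 0` it consists of the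
monomials `v_j^{m_j} ⋯ v_0^{m_0}` with `m_j ≠ 0` and `∑ m_i = k`. Their range projections are
`P_1^{⊗j} ⊗ I`, and their initial projections partition the basis. Indeed, distributing `k` units
greedily over the legs of `e_{(s,w)}`, at most `w_i` in leg `i` and any remainder in the extra
coordinate `n`, gives exactly one such `m` (`exists_isHead`, `IsHead.unique`). Stars and bars on `k
- 1` units in `j + 1` coordinates gives the multiplicity of the `j`-th projection. -/

theorem adjoint_weightedComp_apply {ι : Type*} (c : ι → ℂ) (φ : ι → ι)
    (hφ : Function.Injective φ) (hc : ∀ i, ‖c i‖ ≤ 1) (f : lp (fun _ : ι => ℂ) 2) (i : ι) :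
    (star (weightedComp c φ hφ hc)) f (φ i) = star (c i) * f i := by
  classical
  have h := lp.inner_single_left (𝕜 := ℂ) (φ i) (1 : ℂ) ((star (weightedComp c φ hφ hc)) f)
  rw [ContinuousLinearMap.star_eq_adjoint, ContinuousLinearMap.adjoint_inner_right] at h
  have h2 : weightedComp c φ hφ hc (lp.single 2 (φ i) (1 : ℂ)) = lp.single 2 i (c i) := by
    ext j
    rw [weightedComp_apply, lp.single_apply, lp.single_apply]
    by_cases hj : j = i
    · subst hj; simp
    · simp [hj, hφ.ne hj]
  rw [h2, lp.inner_single_left] at h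
  rw [ContinuousLinearMap.star_eq_adjoint]
  simpa [mul_comm] using h.symm

/-- The hypothesis covers both ways in which `e_j` can be killed: `j` lies outside the range of `φ`,
or its preimage has weight zero. -/
theorem adjoint_weightedComp_apply_eq_zero {ι : Type*} (c : ι → ℂ) (φ : ι → ι)
    (hφ : Function.Injective φ) (hc : ∀ i, ‖c i‖ ≤ 1) (f : lp (fun _ : ι => ℂ) 2) (j : ι)
    (hj : ∀ i, φ i = j → c i = 0) :
    (star (weightedComp c φ hφ hc)) f j = 0 := by
  classical
  have h := lp.inner_single_left (𝕜 := ℂ) j (1 : ℂ) ((star (weightedComp c φ hφ hc)) f)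
  rw [ContinuousLinearMap.star_eq_adjoint, ContinuousLinearMap.adjoint_inner_right] at h
  have h2 : weightedComp c φ hφ hc (lp.single 2 j (1 : ℂ)) = 0 := by
    ext i
    rw [weightedComp_apply, lp.single_apply]
    by_cases hi : φ i = j
    · simp [hj i hi]
    · simp [hi]
  rw [h2, inner_zero_left] at h
  rw [ContinuousLinearMap.star_eq_adjoint]
  simpa using h.symm

/-- A diagonal operator is bounded by any bound on its eigenvalues. -/
theorem norm_le_of_diagonal {ι : Type*}
    (T : lp (fun _ : ι => ℂ) 2 →L[ℂ] lp (fun _ : ι => ℂ) 2) (d : ι → ℂ)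
    (hT : ∀ f i, T f i = d i * f i) {C : ℝ} (hC : 0 ≤ C) (hd : ∀ i, ‖d i‖ ≤ C) : ‖T‖ ≤ C := by
  refine T.opNorm_le_bound hC fun f => ?_
  have h : ‖T f‖ ≤ ‖(C : ℂ) • f‖ := by
    refine lp.norm_mono (by norm_num) fun i => ?_
    rw [hT, norm_mul, lp.coeFn_smul, Pi.smul_apply, norm_smul]
    refine mul_le_mul_of_nonneg_right ((hd i).trans ?_) (norm_nonneg _)
    simp [abs_of_nonneg hC]
  rwa [norm_smul, Complex.norm_real, Real.norm_of_nonneg hC] at h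

theorem aeval_apply_of_diagonal {ι : Type*}
    (T : lp (fun _ : ι => ℂ) 2 →L[ℂ] lp (fun _ : ι => ℂ) 2) (d : ι → ℝ)
    (hT : ∀ f i, T f i = d i * f i) (P : Polynomial ℝ) (f : lp (fun _ : ι => ℂ) 2) (i : ι) :
    Polynomial.aeval T (P.map (algebraMap ℝ ℂ)) f i = ((P.eval (d i) : ℝ) : ℂ) * f i := by
  induction P using Polynomial.induction_on' with
  | add P Q hP hQ =>
    rw [Polynomial.map_add, map_add, add_apply, lp.coeFn_add, Pi.add_apply, hP, hQ,
      Polynomial.eval_add, Complex.ofReal_add, add_mul]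
  | monomial m a =>
    have hpow : ∀ (m : ℕ) (f : lp (fun _ : ι => ℂ) 2), (T ^ m) f i = (d i : ℂ) ^ m * f i := by
      intro m
      induction m with
      | zero => simp
      | succ m ih => intro f; rw [pow_succ, mul_apply_eq_comp, ih, hT]; ring
    rw [Polynomial.map_monomial, Polynomial.aeval_monomial, ← Algebra.smul_def, smul_apply,
      lp.coeFn_smul, Pi.smul_apply, hpow]
    simp [mul_assoc]

/-- Continuous functional calculus for diagonal operators. -/
theorem mem_of_diagonal {ι : Type*}
    (A : StarSubalgebra ℂ (lp (fun _ : ι => ℂ) 2 →L[ℂ] lp (fun _ : ι => ℂ) 2))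
    (hA : IsClosed (A : Set (lp (fun _ : ι => ℂ) 2 →L[ℂ] lp (fun _ : ι => ℂ) 2)))
    {T S : lp (fun _ : ι => ℂ) 2 →L[ℂ] lp (fun _ : ι => ℂ) 2} (hTA : T ∈ A) {d : ι → ℝ}
    (hT : ∀ f i, T f i = d i * f i) {a b : ℝ} (hd : ∀ i, d i ∈ Set.Icc a b) {F : ℝ → ℝ}
    (hF : ContinuousOn F (Set.Icc a b)) (hS : ∀ f i, S f i = ((F (d i) : ℝ) : ℂ) * f i) :
    S ∈ A := by
  rw [← SetLike.mem_coe, ← hA.closure_eq, Metric.mem_closure_iff]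
  intro ε hε
  -- Weierstrass approximation suffices: the norm of a diagonal operator is controlled by its
  -- eigenvalues, all of which come from `[a, b]`.
  obtain ⟨P, hP⟩ := exists_polynomial_near_of_continuousOn a b F hF (ε / 2) (by positivity)
  refine ⟨Polynomial.aeval T (P.map (algebraMap ℝ ℂ)), ?_, ?_⟩
  · exact Algebra.adjoin_le (S := A.toSubalgebra) (Set.singleton_subset_iff.mpr hTA)
      (Polynomial.aeval_mem_adjoin_singleton ℂ T)
  · rw [dist_eq_norm]
    refine (norm_le_of_diagonal _ (fun i => ((F (d i) - P.eval (d i) : ℝ) : ℂ)) ?_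
      (by positivity : 0 ≤ ε / 2) ?_).trans_lt (by linarith)
    · intro f i
      have := aeval_apply_of_diagonal T d hT P f i
      rw [sub_apply, lp.coeFn_sub, Pi.sub_apply, this, hS]
      push_cast; ring
    · intro i
      rw [Complex.norm_real, norm_sub_rev]
      exact (hP _ (hd i)).le

/-! ### Partial isometries in the sphere algebra -/

/-- The indicator function of the basis vectors `e_{(s,w)}` with `w i = 0` for `i < l`. -/
def cornerWt (n l : ℕ) (p : ℤ × (Fin n → ℕ)) : ℂ :=
  if ∀ i : Fin n, i.val < l → p.2 i = 0 then 1 else 0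

theorem norm_cornerWt_le_one (n l : ℕ) (p : ℤ × (Fin n → ℕ)) : ‖cornerWt n l p‖ ≤ 1 := by
  unfold cornerWt; split_ifs <;> simp

theorem star_cornerWt (n l : ℕ) (p : ℤ × (Fin n → ℕ)) : star (cornerWt n l p) = cornerWt n l p := by
  unfold cornerWt; split_ifs <;> simp

theorem cornerWt_mul_self (n l : ℕ) (p : ℤ × (Fin n → ℕ)) :
    cornerWt n l p * cornerWt n l p = cornerWt n l p := by
  unfold cornerWt; split_ifs <;> simp

theorem stdProj_apply (n l : ℕ) (f : H n) (p : ℤ × (Fin n → ℕ)) :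
    stdProj n l f p = cornerWt n l p * f p := by
  rw [stdProj, tensorProj, weightedComp_apply, cornerWt]
  congr 2
  refine propext (forall_congr' fun i => ?_)
  split_ifs with h <;> simp [h]

/-- Translation of the multi-index by the first `n` coordinates of `m`, and of the integer index by
the negative of the sum of all of them. -/
def src (n : ℕ) (m : Fin (n + 1) → ℕ) (p : ℤ × (Fin n → ℕ)) : ℤ × (Fin n → ℕ) :=
  (p.1 - ((∑ i, m i : ℕ) : ℤ), fun i => p.2 i + m i.castSucc)

theorem src_injective (n : ℕ) (m : Fin (n + 1) → ℕ) : Function.Injective (src n m) := by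
  rintro ⟨s, w⟩ ⟨s', w'⟩ h
  simp only [src, Prod.mk.injEq, sub_left_inj] at h
  exact Prod.ext h.1 (funext fun i => Nat.add_right_cancel (congrFun h.2 i))

theorem src_src (n : ℕ) (m m' : Fin (n + 1) → ℕ) (p : ℤ × (Fin n → ℕ)) :
    src n m' (src n m p) = src n (m + m') p := by
  refine Prod.ext ?_ (funext fun i => ?_)
  · simp only [src, Pi.add_apply, Finset.sum_add_distrib]
    push_cast; ring
  · simp only [src, Pi.add_apply]; ring

theorem genSrc_eq_src (n : ℕ) (l : Fin (n + 1)) : genSrc n l = src n (Pi.single l 1) := by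
  funext p
  refine Prod.ext ?_ (funext fun i => ?_)
  · simp [genSrc, src, Finset.sum_pi_single']
  · by_cases h : i.val = l.val
    · have : i.castSucc = l := Fin.ext h
      simp [genSrc, src, this, h]
    · have : i.castSucc ≠ l := fun h' => h (congrArg Fin.val h')
      simp [genSrc, src, this, h]

/-- The partial isometry sending `e_{src n m p}` to `e_p` when `p` vanishes in the first `l` legs,
and killing all other basis vectors. -/
def shiftOp (n : ℕ) (l : ℕ) (m : Fin (n + 1) → ℕ) : B n :=
  weightedComp (cornerWt n l) (src n m) (src_injective n m) (norm_cornerWt_le_one n l)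

theorem shiftOp_apply (n l : ℕ) (m : Fin (n + 1) → ℕ) (f : H n) (p : ℤ × (Fin n → ℕ)) :
    shiftOp n l m f p = cornerWt n l p * f (src n m p) := rfl

theorem star_shiftOp_apply_src (n l : ℕ) (m : Fin (n + 1) → ℕ) (f : H n) (p : ℤ × (Fin n → ℕ)) :
    (star (shiftOp n l m)) f (src n m p) = cornerWt n l p * f p := by
  rw [shiftOp, adjoint_weightedComp_apply, star_cornerWt]

theorem shiftOp_mul_star (n l : ℕ) (m : Fin (n + 1) → ℕ) :
    shiftOp n l m * star (shiftOp n l m) = stdProj n l := by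
  ext f p
  rw [mul_apply_eq_comp, shiftOp_apply, star_shiftOp_apply_src, stdProj_apply, ← mul_assoc,
    cornerWt_mul_self]

theorem cornerWt_zero (n : ℕ) (p : ℤ × (Fin n → ℕ)) : cornerWt n 0 p = 1 := by
  simp [cornerWt]

theorem stdProj_zero (n : ℕ) : stdProj n 0 = 1 := by
  ext f p
  simp [stdProj_apply, cornerWt_zero]

theorem shiftOp_zero_zero (n : ℕ) : shiftOp n 0 0 = 1 := by
  ext f p
  simp [shiftOp_apply, cornerWt_zero, src]

/-- A shift supported in legs at most `l'` after one in leg `l ≥ l'`. -/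
theorem shiftOp_single_mul_shiftOp (n : ℕ) {l l' : Fin (n + 1)} (h : l' ≤ l)
    (m : Fin (n + 1) → ℕ) :
    shiftOp n l (Pi.single l 1) * shiftOp n l' m = shiftOp n l (Pi.single l 1 + m) := by
  ext f p
  rw [mul_apply_eq_comp, shiftOp_apply, shiftOp_apply, shiftOp_apply, src_src, ← mul_assoc]
  congr 1
  unfold cornerWt
  by_cases hp : ∀ i : Fin n, i.val < l.val → p.2 i = 0
  · rw [if_pos hp, if_pos, one_mul]
    intro i hi
    have hil : i.val < l.val := lt_of_lt_of_le hi h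
    have : i.castSucc ≠ l := fun h' => hil.ne (congrArg Fin.val h')
    simp [src, hp i hil, this]
  · rw [if_neg hp, zero_mul]

theorem alphaWt_zero_pos {q : ℝ} (hq : 1 < q) : 0 < alphaWt q 0 := by
  unfold alphaWt
  refine Real.sqrt_pos.mpr ?_
  have : (q ^ (0 + 1))⁻¹ < 1 := inv_lt_one_of_one_lt₀ (by simpa using hq)
  have h0 : 0 < (q ^ (0 + 1))⁻¹ := by positivity
  nlinarith

theorem alphaWt_zero_le {q : ℝ} (hq : 1 < q) (j : ℕ) : alphaWt q 0 ≤ alphaWt q j := by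
  unfold alphaWt
  gcongr
  · exact hq.le
  · exact Nat.zero_le j

/-- On the corner where the first `l` legs vanish, the weights of the generators are bounded
below. -/
theorem le_genWt (n : ℕ) {q : ℝ} (hq : 1 < q) (l : Fin (n + 1)) (w : Fin n → ℕ)
    (hw : ∀ i : Fin n, i.val < l.val → w i = 0) :
    (gammaWt q 0 * alphaWt q 0) ^ n ≤ genWt n q l w := by
  have hα := alphaWt_zero_pos hq
  have hγ := gammaWt_nonneg hq 0
  have hγ1 := gammaWt_le_one hq 0
  have hα1 := alphaWt_le_one q 0
  calc (gammaWt q 0 * alphaWt q 0) ^ n = ∏ _i : Fin n, gammaWt q 0 * alphaWt q 0 := by simp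
    _ ≤ genWt n q l w := by
      refine Finset.prod_le_prod (fun i _ => by positivity) fun i _ => ?_
      split_ifs with h1 h2
      · rw [hw i h1]; exact mul_le_of_le_one_right hγ hα1
      · exact (mul_le_of_le_one_left hα.le hγ1).trans (alphaWt_zero_le hq _)
      · exact mul_le_one₀ hγ1 hα.le hα1

/-- If the projection onto the corner lies in the sphere algebra, then so does the phase of the
generator cut down by it. -/
theorem shiftOp_single_mem (n : ℕ) (q : ℝ) (hq : 1 < q) (l : Fin (n + 1))
    (h : stdProj n l ∈ sphere n q hq) : shiftOp n l (Pi.single l 1) ∈ sphere n q hq := by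
  classical
  -- The uniform lower bound of `le_genWt` for the weights on the corner.
  set r : ℝ := (gammaWt q 0 * alphaWt q 0) ^ n with hr
  have hr0 : 0 < r := by
    have := alphaWt_zero_pos hq
    have : 0 < gammaWt q 0 := by unfold gammaWt; positivity
    positivity
  have hgen : ∀ (f : H n) p, gen n q hq l f p = ((genWt n q l p.2 : ℝ) : ℂ) * f (genSrc n l p) :=
    fun f p => rfl
  have hgen' : ∀ (f : H n) p, (star (gen n q hq l)) f (genSrc n l p) =
      ((genWt n q l p.2 : ℝ) : ℂ) * f p := fun f p => by
    rw [gen, adjoint_weightedComp_apply]; simp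
  set d : ℤ × (Fin n → ℕ) → ℝ :=
    fun p => if ∀ i : Fin n, i.val < l.val → p.2 i = 0 then genWt n q l p.2 ^ 2 else 0 with hd
  have hgen1 : ∀ w, |genWt n q l w| ≤ 1 := fun w => by
    simpa using norm_genWt_le_one n hq l w
  -- On the corner this is `r / genWt`, the inverse of the modulus up to scale. The cutoff at `r ^
  -- 2` makes it continuous at `0`, the eigenvalue off the corner; the factor `r` keeps it at most
  -- `1`, as `weightedComp` requires.
  set F : ℝ → ℝ := fun x => r / √(max x (r ^ 2)) with hF
  have hpos : ∀ x, 0 < √(max x (r ^ 2)) := fun x =>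
    Real.sqrt_pos.mpr (lt_of_lt_of_le (by positivity) (le_max_right _ _))
  have hF1 : ∀ x, ‖((F x : ℝ) : ℂ)‖ ≤ 1 := fun x => by
    rw [Complex.norm_real, Real.norm_of_nonneg (div_nonneg hr0.le (hpos x).le)]
    refine (div_le_one (hpos x)).mpr (Real.le_sqrt_of_sq_le (le_max_right _ _))
  have hS : weightedComp (fun p => ((F (d p) : ℝ) : ℂ)) id Function.injective_id
      (fun p => hF1 (d p)) ∈ sphere n q hq := by
    refine mem_of_diagonal (sphere n q hq) (StarSubalgebra.isClosed_topologicalClosure _)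
      (T := stdProj n l * (gen n q hq l * star (gen n q hq l)))
      (mul_mem h (mul_mem (gen_mem n q hq l) (star_mem (gen_mem n q hq l))))
      (d := d) (a := 0) (b := 1) (F := F) ?_ ?_ ?_ (fun f p => rfl)
    · intro f p
      rw [mul_apply_eq_comp, stdProj_apply, mul_apply_eq_comp, hgen, hgen', hd, cornerWt]
      dsimp only
      split_ifs
      · push_cast; ring
      · simp
    · intro p
      rw [hd]; dsimp only
      split_ifs
      · exact ⟨sq_nonneg _, (sq_le_one_iff_abs_le_one _).mpr (hgen1 _)⟩
      · simp
    · exact Continuous.continuousOn (continuous_const.div (by fun_prop) fun x => (hpos x).ne')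
  have key : shiftOp n l (Pi.single l 1) = ((r : ℂ)⁻¹) • (weightedComp (fun p => ((F (d p) : ℝ) : ℂ))
      id Function.injective_id (fun p => hF1 (d p)) * (stdProj n l * gen n q hq l)) := by
    ext f p
    rw [smul_apply, lp.coeFn_smul, Pi.smul_apply, mul_apply_eq_comp, weightedComp_apply,
      mul_apply_eq_comp, stdProj_apply, hgen, shiftOp_apply, ← genSrc_eq_src, smul_eq_mul]
    by_cases hp : ∀ i : Fin n, i.val < l.val → p.2 i = 0
    · have hle := le_genWt n hq l p.2 hp
      have hFd : F (d p) = r / genWt n q l p.2 := by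
        have : d p = genWt n q l p.2 ^ 2 := if_pos hp
        rw [hF, this]
        dsimp only
        rw [max_eq_left (pow_le_pow_left₀ hr0.le hle 2), Real.sqrt_sq (hr0.le.trans hle)]
      have hg : ((genWt n q l p.2 : ℝ) : ℂ) ≠ 0 :=
        Complex.ofReal_ne_zero.mpr (hr0.trans_le hle).ne'
      have hrc : (r : ℂ) ≠ 0 := Complex.ofReal_ne_zero.mpr hr0.ne'
      simp only [cornerWt, id, if_pos hp, hFd]
      push_cast
      field_simp
    · simp [cornerWt, if_neg hp]
  rw [key]
  exact SMulMemClass.smul_mem _ (mul_mem hS (mul_mem h (gen_mem n q hq l)))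

/-- The initial projection of the phase selects, within the corner of the first `l` legs, the basis
vectors whose leg `l` is at least `1`; removing them leaves those with leg `l` equal to `0`. -/
theorem stdProj_succ (n : ℕ) (l : Fin n) :
    stdProj n (l + 1) = stdProj n l - star (shiftOp n l (Pi.single l.castSucc 1)) *
      shiftOp n l (Pi.single l.castSucc 1) := by
  ext f p
  rw [sub_apply, lp.coeFn_sub, Pi.sub_apply, mul_apply_eq_comp, stdProj_apply, stdProj_apply]
  rcases Nat.eq_zero_or_pos (p.2 l) with h0 | hpos
  · have hz : (star (shiftOp n l (Pi.single l.castSucc 1)))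
        (shiftOp n l (Pi.single l.castSucc 1) f) p = 0 := by
      refine adjoint_weightedComp_apply_eq_zero _ _ _ _ _ _ fun p' hp' => ?_
      rw [← hp'] at h0
      simp [src] at h0
    rw [hz, sub_zero]
    congr 1
    unfold cornerWt
    congr 1
    refine propext ⟨fun h i hi => h i (by omega), fun h i hi => ?_⟩
    rcases Nat.lt_succ_iff_lt_or_eq.mp hi with hi | hi
    · exact h i hi
    · rwa [Fin.ext hi]
  · obtain ⟨p', rfl⟩ : ∃ p', src n (Pi.single l.castSucc 1) p' = p := by
      refine ⟨(p.1 + 1, Function.update p.2 l (p.2 l - 1)), Prod.ext ?_ (funext fun i => ?_)⟩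
      · simp [src, Finset.sum_pi_single']
      · by_cases hi : i = l
        · subst hi
          simp only [src, Function.update_self, Pi.single_eq_same]; omega
        · simp [src, hi]
    rw [star_shiftOp_apply_src, shiftOp_apply, ← mul_assoc, cornerWt_mul_self]
    have h1 : cornerWt n (l + 1) (src n (Pi.single l.castSucc 1) p') = 0 :=
      if_neg fun h => hpos.ne' (h l (Nat.lt_succ_self _))
    have h2 : cornerWt n l (src n (Pi.single l.castSucc 1) p') = cornerWt n l p' := by
      unfold cornerWt
      congr 1
      refine propext (forall₂_congr fun i hi => ?_)
      have : i ≠ l := fun h' => hi.ne (congrArg Fin.val h')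
      simp [src, this]
    rw [h1, h2]; ring

/-- Each corner yields a phase by `shiftOp_single_mem`, and that phase yields the next corner by
`stdProj_succ`. -/
theorem stdProj_mem (n : ℕ) (q : ℝ) (hq : 1 < q) (l : ℕ) (hl : l ≤ n) :
    stdProj n l ∈ sphere n q hq := by
  induction l with
  | zero => rw [stdProj_zero]; exact one_mem _
  | succ l ih =>
    have h := ih (by omega)
    have hs := shiftOp_single_mem n q hq (Fin.castSucc ⟨l, hl⟩) h
    rw [stdProj_succ n ⟨l, hl⟩]
    exact sub_mem h (mul_mem (star_mem hs) hs)

/-- Factors are peeled off on the left: the phase in leg `l` times the shift by `u` in the corner of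
the last nonzero coordinate of `u`. Writing the index as `Pi.single l 1 + u` guarantees a factor in
leg `l`, which creates the corner. -/
theorem shiftOp_mem (n : ℕ) (q : ℝ) (hq : 1 < q) (l : Fin (n + 1)) (u : Fin (n + 1) → ℕ)
    (hu : ∀ i, u i ≠ 0 → i ≤ l) : shiftOp n l (Pi.single l 1 + u) ∈ sphere n q hq := by
  have hv : ∀ l : Fin (n + 1), shiftOp n l (Pi.single l 1) ∈ sphere n q hq := fun l =>
    shiftOp_single_mem n q hq l (stdProj_mem n q hq l (Nat.lt_succ_iff.mp l.2))
  induction hN : ∑ i, u i generalizing u l with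
  | zero =>
    have : u = 0 := funext fun i => Finset.sum_eq_zero_iff.mp hN i (Finset.mem_univ i)
    rw [this, add_zero]
    exact hv l
  | succ N ih =>
    have hne : (Finset.univ.filter fun i => u i ≠ 0).Nonempty := by
      by_contra hem
      rw [Finset.not_nonempty_iff_eq_empty, Finset.filter_eq_empty_iff] at hem
      rw [Finset.sum_eq_zero (fun i hi => not_not.mp (hem hi))] at hN
      omega
    set l' := (Finset.univ.filter fun i => u i ≠ 0).max' hne with hl'
    have hl'u : u l' ≠ 0 := (Finset.mem_filter.mp (Finset.max'_mem _ hne)).2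
    have hmax : ∀ i, u i ≠ 0 → i ≤ l' := fun i hi =>
      Finset.le_max' _ i (Finset.mem_filter.mpr ⟨Finset.mem_univ i, hi⟩)
    have hsplit : u = Pi.single l' 1 + (u - Pi.single l' 1) := by
      funext i
      by_cases hi : i = l'
      · rw [hi]; simp only [Pi.add_apply, Pi.sub_apply, Pi.single_eq_same]; omega
      · simp [hi]
    have hsum : ∑ i, (u - Pi.single l' 1 : Fin (n + 1) → ℕ) i = N := by
      rw [hsplit] at hN
      simp only [Pi.add_apply, Finset.sum_add_distrib, Finset.sum_pi_single', Finset.mem_univ,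
        if_true] at hN
      omega
    have hmem := ih l' (u - Pi.single l' 1)
      (fun i hi => hmax i fun h0 => hi (by simp [h0])) hsum
    rw [← hsplit] at hmem
    rw [← shiftOp_single_mul_shiftOp n (hu l' hl'u) u]
    exact mul_mem (hv l) hmem

/-! ### Spectral subspaces as projective modules -/

theorem gauge_shiftOp (n l : ℕ) (m : Fin (n + 1) → ℕ) (t : Circle) :
    gauge n t (shiftOp n l m) = ((t : ℂ) ^ (((∑ i, m i : ℕ) : ℤ))) • shiftOp n l m := by
  rw [gauge_apply]
  ext f p
  have ht : (t : ℂ) ≠ 0 := Circle.coe_ne_zero t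
  rw [mul_apply_eq_comp, mul_apply_eq_comp, gaugeOp_apply, shiftOp_apply, gaugeOp_apply, smul_apply,
    lp.coeFn_smul, Pi.smul_apply, smul_eq_mul, shiftOp_apply, inv_zpow', Circle.coe_zpow,
    Circle.coe_zpow]
  have : (t : ℂ) ^ p.1 * (t : ℂ) ^ (-(src n m p).1) = (t : ℂ) ^ (((∑ i, m i : ℕ) : ℤ)) := by
    rw [← zpow_add₀ ht]
    congr 1
    simp only [src]; ring
  rw [← this]; ring

theorem mk_shiftOp_mem_lineBundle (n : ℕ) (q : ℝ) (hq : 1 < q) (l : ℕ) (m : Fin (n + 1) → ℕ)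
    (h : shiftOp n l m ∈ sphere n q hq) (k : ℤ) (hk : ((∑ i, m i : ℕ) : ℤ) = k) :
    (⟨shiftOp n l m, h⟩ : sphere n q hq) ∈ lineBundle n q hq k := fun t =>
  Subtype.ext (hk ▸ gauge_shiftOp n l m t)

theorem star_mem_lineBundle (n : ℕ) (q : ℝ) (hq : 1 < q) {k : ℤ} {a : sphere n q hq}
    (ha : a ∈ lineBundle n q hq k) : star a ∈ lineBundle n q hq (-k) := fun t => by
  rw [map_star, ha t, star_smul]
  congr 1
  rw [zpow_neg, ← inv_zpow, star_zpow₀, ← Circle.coe_inv, Circle.coe_inv_eq_conj]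
  rfl

theorem mul_mem_lineBundle (n : ℕ) (q : ℝ) (hq : 1 < q) {k l : ℤ} {a b : sphere n q hq}
    (ha : a ∈ lineBundle n q hq k) (hb : b ∈ lineBundle n q hq l) :
    a * b ∈ lineBundle n q hq (k + l) := fun t => by
  rw [map_mul, ha t, hb t, smul_mul_smul_comm, zpow_add₀ (Circle.coe_ne_zero t)]

theorem mem_projSpace_iff (n : ℕ) (q : ℝ) (hq : 1 < q) (a : sphere n q hq) :
    a ∈ projSpace n q hq ↔ a ∈ lineBundle n q hq 0 :=
  forall_congr' fun t => by rw [zpow_zero, one_smul]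

/-- A finite family `b` in `L` with `b x * star (b y) = δ_{xy} p x` and `∑ star (b x) * b x = 1`
identifies `L` with the module of the diagonal matrix with entries `p x`. -/
theorem nonempty_equiv_matrixModule_diagonal {R : Type*} [Ring R] [StarRing R] [Algebra ℂ R]
    [StarModule ℂ R] (A : StarSubalgebra ℂ R) (L : Submodule A R) {ι : Type*} [Fintype ι]
    [DecidableEq ι] (b : ι → R) (hb : ∀ x, b x ∈ L) (hmem : ∀ a ∈ L, ∀ x, a * star (b x) ∈ A)
    (p : ι → A) (hp : ∀ x, b x * star (b x) = (p x : R))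
    (horth : ∀ x y, x ≠ y → b x * star (b y) = 0) (hsum : ∑ x, star (b x) * b x = 1) :
    Nonempty (L ≃ₗ[A] matrixModule (Matrix.diagonal p)) := by
  -- Multiply `∑ star (b y) * b y = 1` on the right by `star (b x)`; orthogonality leaves one term.
  have hstar : ∀ x, star (b x) * (p x : R) = star (b x) := fun x => by
    rw [← hp, ← mul_assoc]
    conv_rhs => rw [← one_mul (star (b x)), ← hsum, Finset.sum_mul]
    rw [Finset.sum_eq_single x]
    · intro y _ hy
      rw [mul_assoc, horth y x hy, mul_zero]
    · simp
  let F : L →ₗ[A] (ι → A) :=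
    { toFun := fun a x => ⟨(a : R) * star (b x), hmem a a.2 x⟩
      map_add' := fun a a' => funext fun x => Subtype.ext (add_mul _ _ _)
      map_smul' := fun c a => funext fun x => Subtype.ext (mul_assoc _ _ _) }
  have hF : ∀ a x, ((F a x : A) : R) = a * star (b x) := fun _ _ => rfl
  have hrec : ∀ a : L, (a : R) = ∑ x, (F a x : R) * b x := fun a => by
    simp only [hF, mul_assoc]
    rw [← Finset.mul_sum, hsum, mul_one]
  have hinj : Function.Injective F := fun a a' h => Subtype.ext <|
    (hrec a).trans ((congrArg (fun v : ι → A => ∑ x, (v x : R) * b x) h).trans (hrec a').symm)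
  -- Tuples `F a` are fixed by the matrix, by `hstar`; conversely the image of `w` under the matrix
  -- is `F (∑ w y * b y)`.
  have hrange : LinearMap.range F = matrixModule (Matrix.diagonal p) := by
    ext v
    simp only [matrixModule, LinearMap.mem_range, Matrix.vecMulLinear_apply]
    constructor
    · rintro ⟨a, rfl⟩
      refine ⟨F a, funext fun x => Subtype.ext ?_⟩
      rw [Matrix.vecMul_diagonal]
      change (F a x : R) * (p x : R) = _
      rw [hF, mul_assoc, hstar]
    · rintro ⟨w, rfl⟩
      have hmemL : ∑ y, (w y : R) * b y ∈ L :=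
        Submodule.sum_mem _ fun y _ => L.smul_mem (w y) (hb y)
      refine ⟨⟨_, hmemL⟩, funext fun x => Subtype.ext ?_⟩
      rw [hF, Matrix.vecMul_diagonal]
      change (∑ y, (w y : R) * b y) * star (b x) = (w x : R) * (p x : R)
      rw [Finset.sum_mul, Finset.sum_eq_single x]
      · rw [mul_assoc, hp]
      · intro y _ hy
        rw [mul_assoc, horth y x hy, mul_zero]
      · simp
  exact ⟨(LinearEquiv.ofInjective F hinj).trans (LinearEquiv.ofEq _ _ hrange)⟩

theorem mul_star_mem_projSpace (n : ℕ) (q : ℝ) (hq : 1 < q) {k : ℤ} {a b : sphere n q hq}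
    (ha : a ∈ lineBundle n q hq k) (hb : b ∈ lineBundle n q hq k) :
    a * star b ∈ projSpace n q hq := by
  rw [mem_projSpace_iff, ← add_neg_cancel k]
  exact mul_mem_lineBundle n q hq ha (star_mem_lineBundle n q hq hb)

theorem isStarProjection_diagonal {A ι : Type*} [Ring A] [StarRing A] [Fintype ι] [DecidableEq ι]
    {p : ι → A} (hp : ∀ x, IsStarProjection (p x)) : IsStarProjection (Matrix.diagonal p) := by
  refine ⟨?_, ?_⟩
  · rw [IsIdempotentElem, Matrix.diagonal_mul_diagonal]
    exact congrArg _ (funext fun x => (hp x).isIdempotentElem)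
  · rw [IsSelfAdjoint, Matrix.star_eq_conjTranspose, Matrix.diagonal_conjTranspose]
    exact congrArg _ (funext fun x => (hp x).isSelfAdjoint)

theorem isStarProjection_mk_projSpace (n : ℕ) (q : ℝ) (hq : 1 < q) (p : projSpace n q hq)
    (hp : IsStarProjection ((p : sphere n q hq) : B n)) : IsStarProjection p :=
  ⟨Subtype.ext (Subtype.ext hp.isIdempotentElem), Subtype.ext (Subtype.ext hp.isSelfAdjoint)⟩

theorem isStarProjection_tensorProj (n : ℕ) (E : Fin n → Set ℕ) :
    IsStarProjection (tensorProj n E) := by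
  classical
  have h : ∀ (f : H n) p, tensorProj n E f p = (if ∀ i, p.2 i ∈ E i then 1 else 0) * f p :=
    fun f p => by rw [tensorProj, weightedComp_apply]; congr
  have h' : ∀ (f : H n) p, (star (tensorProj n E)) f p =
      (if ∀ i, p.2 i ∈ E i then 1 else 0) * f p := fun f p => by
    refine (adjoint_weightedComp_apply _ id Function.injective_id _ f p).trans ?_
    split_ifs <;> simp
  refine ⟨?_, ?_⟩
  · ext f p
    rw [mul_apply_eq_comp, h, h]
    split_ifs <;> simp
  · ext f p
    rw [h', h]

/-! ### Heads of multi-indices -/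

/-- `m` has last nonzero coordinate `j`, agrees with `w` before `j`, and is bounded by `w` at `j`
if `j < n`. -/
structure IsHead {n : ℕ} (w : Fin n → ℕ) (j : Fin (n + 1)) (m : Fin (n + 1) → ℕ) : Prop where
  ne_zero : m j ≠ 0
  eq_zero : ∀ i, j < i → m i = 0
  le : ∀ i : Fin n, m i.castSucc ≤ w i
  eq : ∀ i : Fin n, i.castSucc < j → m i.castSucc = w i

theorem IsHead.eq_of_le {n : ℕ} {w : Fin n → ℕ} {j j' : Fin (n + 1)} {m m' : Fin (n + 1) → ℕ}
    (h : IsHead w j m) (h' : IsHead w j' m') (hs : ∑ i, m i = ∑ i, m' i)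
    (hj : j < j' ∨ j = j' ∧ m j ≤ m' j) : j = j' ∧ m = m' := by
  -- Before `j'` the second head takes all of `w`, the most allowed, and after `j'` both vanish, so
  -- the heads compare pointwise; equal sums then force equality.
  have hle : ∀ i ∈ Finset.univ, m i ≤ m' i := by
    intro i _
    rcases lt_trichotomy i j' with hi | hi | hi
    · obtain ⟨i, rfl⟩ : ∃ i₀ : Fin n, i₀.castSucc = i :=
        ⟨i.castPred (hi.trans_le (Fin.le_last _)).ne, Fin.castSucc_castPred _ _⟩
      rw [h'.eq i hi]
      exact h.le i
    · subst hi
      rcases hj with hj | ⟨hj, hle⟩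
      · rw [h.eq_zero _ hj]; exact Nat.zero_le _
      · rwa [← hj]
    · have : j < i := by
        rcases hj with hj | ⟨hj, -⟩
        · exact hj.trans hi
        · rwa [hj]
      rw [h.eq_zero i this]; exact Nat.zero_le _
  have hm : m = m' := funext fun i =>
    (Finset.sum_eq_sum_iff_of_le hle).mp hs i (Finset.mem_univ i)
  refine ⟨?_, hm⟩
  rcases hj with hj | ⟨hj, -⟩
  · exact absurd (hm ▸ h.eq_zero _ hj) h'.ne_zero
  · exact hj

theorem IsHead.unique {n : ℕ} {w : Fin n → ℕ} {j j' : Fin (n + 1)} {m m' : Fin (n + 1) → ℕ}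
    (h : IsHead w j m) (h' : IsHead w j' m') (hs : ∑ i, m i = ∑ i, m' i) : j = j' ∧ m = m' := by
  rcases lt_trichotomy j j' with hj | hj | hj
  · exact h.eq_of_le h' hs (Or.inl hj)
  · rcases le_total (m j) (m' j) with hm | hm
    · exact h.eq_of_le h' hs (Or.inr ⟨hj, hm⟩)
    · have := h'.eq_of_le h hs.symm (Or.inr ⟨hj.symm, hj ▸ hm⟩)
      exact ⟨this.1.symm, this.2.symm⟩
  · have := h'.eq_of_le h hs.symm (Or.inl hj)
    exact ⟨this.1.symm, this.2.symm⟩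

theorem exists_isHead {n : ℕ} (w : Fin n → ℕ) {k : ℕ} (hk : 0 < k) :
    ∃ j m, IsHead w j m ∧ ∑ i, m i = k := by
  classical
  -- The value `k` past the legs ensures that the partial sums reach `k` by index `n`. The head
  -- stops at the first index `j` where they do; minimality makes the remainder placed there
  -- nonzero.
  let W : ℕ → ℕ := fun i => if h : i < n then w ⟨i, h⟩ else k
  have hex : ∃ j, k ≤ ∑ i ∈ Finset.range (j + 1), W i :=
    ⟨n, by rw [Finset.sum_range_succ]; simp [W]⟩
  set j := Nat.find hex with hj
  have hjn : j ≤ n := Nat.find_min' hex (by rw [Finset.sum_range_succ]; simp [W])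
  have hlt : ∑ i ∈ Finset.range j, W i < k := by
    rcases Nat.eq_zero_or_pos j with h0 | hpos
    · rw [h0]; simpa using hk
    · have := Nat.find_min hex (m := j - 1) (by omega)
      rw [Nat.sub_add_cancel hpos] at this
      exact not_le.mp this
  have hge : k ≤ ∑ i ∈ Finset.range j, W i + W j := by
    rw [← Finset.sum_range_succ]; exact Nat.find_spec hex
  let g : ℕ → ℕ := fun i =>
    if i < j then W i else if i = j then k - ∑ i ∈ Finset.range j, W i else 0
  have hg1 : ∀ i, i < j → g i = W i := fun i hi => if_pos hi
  have hg2 : g j = k - ∑ i ∈ Finset.range j, W i := by simp [g]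
  have hg3 : ∀ i, j < i → g i = 0 := fun i hi => by simp [g, hi.not_gt, hi.ne']
  have hW : ∀ i : Fin n, W i = w i := fun i => dif_pos i.2
  refine ⟨⟨j, by omega⟩, fun i => g i, ⟨?_, fun i hi => hg3 i hi, fun i => ?_, fun i hi => ?_⟩, ?_⟩
  · change g j ≠ 0
    omega
  · change g i ≤ w i
    rcases lt_trichotomy i.val j with hi | hi | hi
    · rw [hg1 _ hi, hW]
    · rw [← hW, hi, hg2]; omega
    · rw [hg3 _ hi]; exact Nat.zero_le _
  · exact (hg1 _ hi).trans (hW i)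
  · rw [Fin.sum_univ_eq_sum_range g (n + 1),
      ← Finset.sum_subset (Finset.range_subset_range.mpr (by omega : j + 1 ≤ n + 1)),
      Finset.sum_range_succ, Finset.sum_congr rfl fun i hi => hg1 i (Finset.mem_range.mp hi), hg2]
    · exact Nat.add_sub_cancel' hlt.le
    · intro i _ hi
      exact hg3 i (by simpa using hi)

/-- Together with `exists_src_of_isHead`, this describes the initial space of `shiftOp n j m`: the
basis vectors `e_{(s,w)}` for which `m` is a head of `w`. -/
theorem isHead_of_src {n : ℕ} {j : Fin (n + 1)} {m : Fin (n + 1) → ℕ} {p : ℤ × (Fin n → ℕ)}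
    (hj : m j ≠ 0) (hm : ∀ i, j < i → m i = 0) (hp : cornerWt n j p ≠ 0) :
    IsHead (src n m p).2 j m := by
  refine ⟨hj, hm, fun i => Nat.le_add_left _ _, fun i hi => ?_⟩
  have h : ∀ i : Fin n, i.val < j.val → p.2 i = 0 := by
    by_contra h
    exact hp (if_neg h)
  simp [src, h i hi]

theorem exists_src_of_isHead {n : ℕ} {j : Fin (n + 1)} {m : Fin (n + 1) → ℕ}
    {p : ℤ × (Fin n → ℕ)} (h : IsHead p.2 j m) : ∃ p', src n m p' = p ∧ cornerWt n j p' = 1 := by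
  refine ⟨(p.1 + ((∑ i, m i : ℕ) : ℤ), fun i => p.2 i - m i.castSucc),
    Prod.ext (by simp [src]) (funext fun i => Nat.sub_add_cancel (h.le i)), if_pos fun i hi => ?_⟩
  change p.2 i - m i.castSucc = 0
  rw [h.eq i hi, Nat.sub_self]

/-- The partial isometries indexed by multi-indices with a given sum are pairwise orthogonal. -/
theorem shiftOp_mul_star_eq_zero {n : ℕ} {j j' : Fin (n + 1)} {m m' : Fin (n + 1) → ℕ}
    (hj : m j ≠ 0) (hm : ∀ i, j < i → m i = 0) (hj' : m' j' ≠ 0) (hm' : ∀ i, j' < i → m' i = 0)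
    (hs : ∑ i, m i = ∑ i, m' i) (hne : ¬(j = j' ∧ m = m')) :
    shiftOp n j m * star (shiftOp n j' m') = 0 := by
  ext f p
  rw [mul_apply_eq_comp, shiftOp_apply]
  by_cases hp : cornerWt n j p = 0
  · simp [hp]
  · have hz : (star (shiftOp n j' m')) f (src n m p) = 0 := by
      refine adjoint_weightedComp_apply_eq_zero _ _ _ _ _ _ fun p' hp' => ?_
      by_contra hc
      have h' := isHead_of_src hj' hm' hc
      rw [hp'] at h'
      exact hne ((isHead_of_src hj hm hp).unique h' hs)
    simp [hz]

/-- Each basis vector has exactly one head of sum `k`, so exactly one summand fixes it and the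
others kill it. The hypotheses `hinj` and `hsurj` say that the family lists every admissible pair
once. -/
theorem sum_star_shiftOp_mul {n k : ℕ} (hk : 0 < k) {ι : Type*} [Fintype ι]
    (j : ι → Fin (n + 1)) (m : ι → Fin (n + 1) → ℕ) (hj : ∀ x, m x (j x) ≠ 0)
    (hm : ∀ x i, j x < i → m x i = 0) (hs : ∀ x, ∑ i, m x i = k)
    (hinj : ∀ x y, j x = j y → m x = m y → x = y)
    (hsurj : ∀ (j' : Fin (n + 1)) (m' : Fin (n + 1) → ℕ), m' j' ≠ 0 → (∀ i, j' < i → m' i = 0) →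
      ∑ i, m' i = k → ∃ x, j x = j' ∧ m x = m') :
    ∑ x, star (shiftOp n (j x) (m x)) * shiftOp n (j x) (m x) = 1 := by
  ext f p
  obtain ⟨j', m', hhead, hsum⟩ := exists_isHead p.2 hk
  obtain ⟨x, rfl, rfl⟩ := hsurj j' m' hhead.ne_zero hhead.eq_zero hsum
  obtain ⟨p', hp', hc⟩ := exists_src_of_isHead hhead
  rw [sum_apply, lp.coeFn_sum, Finset.sum_apply, Finset.sum_eq_single x]
  · rw [mul_apply_eq_comp, ← hp', star_shiftOp_apply_src, shiftOp_apply, hc]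
    simp
  · intro y _ hy
    rw [mul_apply_eq_comp]
    refine adjoint_weightedComp_apply_eq_zero _ _ _ _ _ _ fun p'' hp'' => ?_
    by_contra hc
    have h' := isHead_of_src (hj y) (hm y) hc
    rw [hp''] at h'
    have := h'.unique hhead ((hs y).trans (hs x).symm)
    exact hy (hinj y x this.1 this.2)
  · simp

/-- Stars and bars: `k - 1` units in `j + 1` coordinates. -/
theorem card_piAntidiag_Iic (n k : ℕ) (hk : 0 < k) (j : Fin (n + 1)) :
    (Finset.piAntidiag (Finset.Iic j) (k - 1)).card = (k + j - 1).choose j := by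
  have h : (Finset.finsuppAntidiag (Finset.Iic j) (k - 1)).card =
      (Finset.piAntidiag (Finset.Iic j) (k - 1)).card := by
    rw [Finset.finsuppAntidiag, Finset.card_map, Finset.card_attach]
  rw [← h, Finset.card_finsuppAntidiag_nat_eq_choose, Fin.card_Iic]
  have h1 : (j : ℕ) + 1 + (k - 1) - 1 = (k - 1) + j := by omega
  have h2 : k + (j : ℕ) - 1 = (k - 1) + j := by omega
  rw [h1, h2, Nat.choose_symm_add]

/-! ### The line bundles -/

theorem shiftOp_zero_mem (n : ℕ) (q : ℝ) (hq : 1 < q) (r : ℕ) :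
    shiftOp n 0 (Pi.single 0 r) ∈ sphere n q hq := by
  -- The zero shift is the identity and is treated apart, since `shiftOp_mem` only provides indices
  -- with a nonzero coordinate.
  rcases r with _ | r
  · rw [Pi.single_zero, shiftOp_zero_zero]
    exact one_mem _
  · have h := shiftOp_mem n q hq 0 (Pi.single 0 r) fun i hi => by
      by_contra h0
      exact hi (Pi.single_eq_of_ne (M := fun _ => ℕ) (fun h => h0 h.le) r)
    rwa [← Pi.single_add, add_comm 1 r] at h

theorem star_shiftOp_zero_mul (n r : ℕ) (hn : 1 ≤ n) :
    star (shiftOp n 0 (Pi.single 0 r)) * shiftOp n 0 (Pi.single 0 r) = negProj n r := by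
  classical
  ext f p
  have hneg : negProj n r f p = (if r ≤ p.2 ⟨0, hn⟩ then 1 else 0) * f p := by
    rw [negProj, tensorProj, weightedComp_apply]
    congr 1
    refine if_congr ⟨fun h => by simpa using h ⟨0, hn⟩, fun h i => ?_⟩ rfl rfl
    split_ifs with hi
    · rwa [show i = ⟨0, hn⟩ from Fin.ext hi]
    · trivial
  have hcast : (⟨0, hn⟩ : Fin n).castSucc = 0 := rfl
  rw [mul_apply_eq_comp, hneg]
  split_ifs with hr
  · obtain ⟨p', rfl⟩ : ∃ p', src n (Pi.single 0 r) p' = p := by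
      refine ⟨(p.1 + r, Function.update p.2 ⟨0, hn⟩ (p.2 ⟨0, hn⟩ - r)),
        Prod.ext ?_ (funext fun i => ?_)⟩
      · simp [src, Finset.sum_pi_single']
      · by_cases hi : i = ⟨0, hn⟩
        · subst hi
          simp only [src, Function.update_self, hcast, Pi.single_eq_same]
          omega
        · have : i.castSucc ≠ 0 := fun h => hi (Fin.castSucc_injective n (h.trans hcast.symm))
          simp [src, hi, this]
    rw [star_shiftOp_apply_src, shiftOp_apply, cornerWt_zero, one_mul]
  · rw [zero_mul]
    refine adjoint_weightedComp_apply_eq_zero _ _ _ _ _ _ fun p' hp' => ?_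
    refine absurd ?_ hr
    rw [← hp']
    simp only [src, hcast, Pi.single_eq_same]
    omega

/-- The frame is the single element `star v`, where `v` has degree `|k|` and `v * star v = 1`; its
range projection `star v * v` is `negProj`. -/
theorem exists_equiv_of_nonpos (n : ℕ) (hn : 1 ≤ n) (q : ℝ) (hq : 1 < q) (k : ℤ) (hk : k ≤ 0) :
    ∃ p : projSpace n q hq, ((p : sphere n q hq) : B n) = negProj n k.natAbs ∧
      IsStarProjection (Matrix.diagonal fun _ : Fin 1 => p) ∧
      Nonempty (lineBundle n q hq k ≃ₗ[projSpace n q hq]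
        matrixModule (Matrix.diagonal fun _ : Fin 1 => p)) := by
  set v : sphere n q hq := ⟨_, shiftOp_zero_mem n q hq k.natAbs⟩ with hv
  have hvL : star v ∈ lineBundle n q hq k := by
    have h := star_mem_lineBundle n q hq (mk_shiftOp_mem_lineBundle n q hq 0
      (Pi.single 0 k.natAbs) (shiftOp_zero_mem n q hq k.natAbs) (-k) (by simp; omega))
    rwa [neg_neg] at h
  have hvv : v * star v = 1 := Subtype.ext ((shiftOp_mul_star n 0 _).trans (stdProj_zero n))
  let p : projSpace n q hq := ⟨star v * star (star v), mul_star_mem_projSpace n q hq hvL hvL⟩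
  have hp : ((p : sphere n q hq) : B n) = negProj n k.natAbs := by
    rw [← star_shiftOp_zero_mul n k.natAbs hn]
    change ((star v * star (star v) : sphere n q hq) : B n) = _
    rw [star_star]; rfl
  refine ⟨p, hp, isStarProjection_diagonal fun _ => isStarProjection_mk_projSpace n q hq p
    (hp ▸ isStarProjection_tensorProj n _), ?_⟩
  refine nonempty_equiv_matrixModule_diagonal _ _ (fun _ : Fin 1 => star v) (fun _ => hvL)
    (fun a ha _ => mul_star_mem_projSpace n q hq ha hvL) _ (fun _ => rfl)
    (fun x y h => absurd (Subsingleton.elim x y) h) ?_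
  simpa using hvv

theorem exists_equiv_of_pos (n : ℕ) (q : ℝ) (hq : 1 < q) (k : ℤ) (hk : 0 < k) :
    ∃ p : Fin (n + 1) → projSpace n q hq,
      (∀ j, ((p j : sphere n q hq) : B n) = stdProj n j) ∧
      IsStarProjection (boxSum n (fun j => (k.natAbs + j - 1).choose j) p) ∧
      Nonempty (lineBundle n q hq k ≃ₗ[projSpace n q hq]
        matrixModule (boxSum n (fun j => (k.natAbs + j - 1).choose j) p)) := by
  have hk' : 0 < k.natAbs := by omega
  have hproj : ∀ j : Fin (n + 1), ∃ p : projSpace n q hq,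
      ((p : sphere n q hq) : B n) = stdProj n j := fun j => by
    have hmem : shiftOp n j (Pi.single j 1) ∈ sphere n q hq := by
      simpa using shiftOp_mem n q hq j 0 (by simp)
    have hL := mk_shiftOp_mem_lineBundle n q hq j (Pi.single j 1) hmem _ rfl
    exact ⟨⟨_, mul_star_mem_projSpace n q hq hL hL⟩, shiftOp_mul_star n j _⟩
  choose p hp using hproj
  refine ⟨p, hp, isStarProjection_diagonal fun x => isStarProjection_mk_projSpace n q hq _
    (hp x.1 ▸ isStarProjection_tensorProj n _), ?_⟩
  -- For fixed last nonzero coordinate `j`, the copies of the `j`-th projection are labelled by the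
  -- multi-indices left after removing the one unit that coordinate `j` must contain.
  let e : ∀ j : Fin (n + 1), Fin ((k.natAbs + j - 1).choose j) ≃
      {u // u ∈ Finset.piAntidiag (Finset.Iic j) (k.natAbs - 1)} := fun j =>
    (Finset.equivFinOfCardEq (card_piAntidiag_Iic n k.natAbs hk' j)).symm
  let u : (Σ j : Fin (n + 1), Fin ((k.natAbs + j - 1).choose j)) → Fin (n + 1) → ℕ :=
    fun x => (e x.1 x.2).1
  have hu : ∀ x i, u x i ≠ 0 → i ≤ x.1 := fun x i hi =>
    Finset.mem_Iic.mp ((Finset.mem_piAntidiag.mp (e x.1 x.2).2).2 i hi)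
  have husum : ∀ x, ∑ i, u x i = k.natAbs - 1 := fun x => by
    rw [← (Finset.mem_piAntidiag.mp (e x.1 x.2).2).1]
    refine (Finset.sum_subset (Finset.subset_univ _) fun i _ hi => ?_).symm
    by_contra h0
    exact hi (Finset.mem_Iic.mpr (hu x i h0))
  let m : (Σ j : Fin (n + 1), Fin ((k.natAbs + j - 1).choose j)) → Fin (n + 1) → ℕ :=
    fun x => Pi.single x.1 1 + u x
  have hm0 : ∀ x, m x x.1 ≠ 0 := fun x => by simp [m]
  have hm : ∀ x i, x.1 < i → m x i = 0 := fun x i hi => by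
    have : u x i = 0 := by
      by_contra h0
      exact (hu x i h0).not_gt hi
    simp [m, this, hi.ne']
  have hmsum : ∀ x, ∑ i, m x i = k.natAbs := fun x => by
    simp only [m, Pi.add_apply, Finset.sum_add_distrib, husum]
    rw [Finset.sum_pi_single', if_pos (Finset.mem_univ _)]
    omega
  have hminj : ∀ x y, x.1 = y.1 → m x = m y → x = y := by
    rintro ⟨j, x⟩ ⟨j', y⟩ (rfl : j = j') h
    have : e j x = e j y := Subtype.ext (add_left_cancel h)
    rw [(e j).injective this]
  have hmsurj : ∀ (j : Fin (n + 1)) (m' : Fin (n + 1) → ℕ), m' j ≠ 0 → (∀ i, j < i → m' i = 0) →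
      ∑ i, m' i = k.natAbs → ∃ x : Σ j : Fin (n + 1), Fin ((k.natAbs + j - 1).choose j),
        x.1 = j ∧ m x = m' := by
    intro j m' hj hz hs
    have hsplit : Pi.single j 1 + (m' - Pi.single j 1) = m' := by
      funext i
      by_cases hi : i = j
      · rw [hi]; simp only [Pi.add_apply, Pi.sub_apply, Pi.single_eq_same]; omega
      · simp [hi]
    have hmem : m' - Pi.single j 1 ∈ Finset.piAntidiag (Finset.Iic j) (k.natAbs - 1) := by
      have hsupp : ∀ i, (m' - Pi.single j 1 : Fin (n + 1) → ℕ) i ≠ 0 → i ∈ Finset.Iic j := by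
        intro i hi
        rw [Finset.mem_Iic]
        by_contra hlt
        exact hi (by simp [hz i (not_le.mp hlt)])
      refine Finset.mem_piAntidiag.mpr ⟨?_, hsupp⟩
      rw [Finset.sum_subset (Finset.subset_univ _) fun i _ hi => not_not.mp (mt (hsupp i) hi)]
      rw [← hsplit] at hs
      simp only [Pi.add_apply, Finset.sum_add_distrib] at hs
      rw [Finset.sum_pi_single', if_pos (Finset.mem_univ _)] at hs
      omega
    refine ⟨⟨j, (e j).symm ⟨_, hmem⟩⟩, rfl, ?_⟩
    simp only [m, u, Equiv.apply_symm_apply]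
    exact hsplit
  have hmS : ∀ x, shiftOp n x.1 (m x) ∈ sphere n q hq := fun x =>
    shiftOp_mem n q hq x.1 (u x) (hu x)
  have hL : ∀ x, (⟨_, hmS x⟩ : sphere n q hq) ∈ lineBundle n q hq k := fun x =>
    mk_shiftOp_mem_lineBundle n q hq x.1 (m x) (hmS x) k (by rw [hmsum]; omega)
  refine nonempty_equiv_matrixModule_diagonal _ _ (fun x => (⟨_, hmS x⟩ : sphere n q hq)) hL
    (fun a ha x => mul_star_mem_projSpace n q hq ha (hL x)) _ (fun x => Subtype.ext ?_)
    (fun x y hxy => Subtype.ext ?_) (Subtype.ext ?_)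
  · exact (shiftOp_mul_star n x.1 (m x)).trans (hp x.1).symm
  · exact shiftOp_mul_star_eq_zero (hm0 x) (hm x) (hm0 y) (hm y) ((hmsum x).trans (hmsum y).symm)
      fun h => hxy (hminj x y h.1 h.2)
  · have h := sum_star_shiftOp_mul hk' (fun x => x.1) m hm0 hm hmsum hminj hmsurj
    rw [AddSubmonoidClass.coe_finsetSum]
    exact h

end QSphere

end

theorem theorem3 (n : ℕ) (hn : 1 ≤ n) (q : ℝ) (hq : 1 < q) (k : ℤ) :
    (k ≤ 0 →
      ∃ p : QSphere.projSpace n q hq,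
        ((p : QSphere.sphere n q hq) : QSphere.B n) = QSphere.negProj n k.natAbs ∧
        IsStarProjection (Matrix.diagonal fun _ : Fin 1 => p) ∧
        Nonempty (QSphere.lineBundle n q hq k ≃ₗ[QSphere.projSpace n q hq]
          QSphere.matrixModule (Matrix.diagonal fun _ : Fin 1 => p))) ∧
    (0 < k →
      ∃ p : Fin (n + 1) → QSphere.projSpace n q hq,
        (∀ j, ((p j : QSphere.sphere n q hq) : QSphere.B n) = QSphere.stdProj n j) ∧
        IsStarProjection (QSphere.boxSum n (fun j => (k.natAbs + j - 1).choose j) p) ∧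
        Nonempty (QSphere.lineBundle n q hq k ≃ₗ[QSphere.projSpace n q hq]
          QSphere.matrixModule (QSphere.boxSum n (fun j => (k.natAbs + j - 1).choose j) p))) :=
  ⟨QSphere.exists_equiv_of_nonpos n hn q hq k, QSphere.exists_equiv_of_pos n q hq k⟩
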